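/- All rings are associative with identity. For a ring $R$, let $U(R)$, $Id(R)$ and $Nil(R)$ denote the sets of units, of idempotents and of nilpotent elements of $R$, respectively. Call $R$ \emph{generalized nil-clean} (GNC) if $R\setminus U(R)\subseteq Id(R)+Nil(R)$, that is, if every element of $R$ that is not a unit is the sum of an idempotent and a nilpotent element of $R$. Lemma. Let $n\ge 2$ be an integer and let $D$ be a division ring. Then the ring $M_n(D)$ of $n\times n$ matrices over $D$ is GNC if and only if $D\cong\mathbb{Z}_2$ as rings, where $\mathbb{Z}_2=\mathbb{Z}/2\mathbb{Z}$ is the field with two elements. -/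

import Mathlib

/-- A ring is *generalized nil-clean* (GNC) if every non-unit is the sum of an idempotent and a
nilpotent element. -/
def IsGNC (R : Type*) [Ring R] : Prop :=
  ∀ a : R, ¬ IsUnit a → ∃ e q : R, IsIdempotentElem e ∧ IsNilpotent q ∧ a = e + q

/-! For `n ≥ 2`, every `a` in `D` gives a non-unit `single i i a`. A nil-clean rank one map has
trace `0` or `1`, so `D` has only two elements. As `D` may be noncommutative, no trace is used, only
an eigenvector argument in the span of `x` and `E x`.

Conversely, over the field with two elements every endomorphism is nil-clean. By induction on
dimension, a cyclic subspace is split off: a block triangular map is nil-clean once its diagonal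
blocks are. A cyclic `T` is a companion matrix, and an idempotent of rank at most two, chosen from
the top coefficients of its polynomial, leaves a nilpotent remainder. -/

/-- An element of a ring is *nil-clean* if it is the sum of an idempotent and a nilpotent. -/
def IsNilCleanElem {R : Type*} [Ring R] (a : R) : Prop :=
  ∃ e q : R, IsIdempotentElem e ∧ IsNilpotent q ∧ a = e + q

theorem IsNilCleanElem.map {R S : Type*} [Ring R] [Ring S] {a : R} (h : IsNilCleanElem a)
    (f : R →+* S) : IsNilCleanElem (f a) := by
  obtain ⟨e, q, he, hq, rfl⟩ := h
  exact ⟨f e, f q, he.map f, hq.map f, map_add f e q⟩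

/-! ### Rank one endomorphisms over a division ring. -/

section RankOne

variable {K V : Type*} [DivisionRing K] [AddCommGroup V] [Module K V]

theorem eq_zero_of_isNilpotent_of_apply_eq_smul {Q : Module.End K V} (hQ : IsNilpotent Q)
    {c : K} {y : V} (hy : y ≠ 0) (h : Q y = c • y) : c = 0 := by
  obtain ⟨k, hk⟩ := hQ
  have key : ∀ m : ℕ, (Q ^ m) y = c ^ m • y := by
    intro m
    induction m with
    | zero => simp
    | succ m ih => rw [pow_succ, Module.End.mul_apply, h, map_smul, ih, smul_smul, pow_succ']
  have h0 := key k
  rw [hk, LinearMap.zero_apply] at h0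
  exact eq_zero_of_pow_eq_zero ((smul_eq_zero.1 h0.symm).resolve_right hy)

theorem exists_ne_zero_mem_apply_eq_zero {Q : Module.End K V} (hQ : IsNilpotent Q)
    {S : Submodule K V} (hS : ∀ z ∈ S, Q z ∈ S) {x : V} (hx : x ∈ S) (hx0 : x ≠ 0) :
    ∃ w ∈ S, w ≠ 0 ∧ Q w = 0 := by
  obtain ⟨k, hk⟩ := hQ
  have key : ∀ m : ℕ, ∀ y ∈ S, y ≠ 0 → (Q ^ m) y = 0 → ∃ w ∈ S, w ≠ 0 ∧ Q w = 0 := by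
    intro m
    induction m with
    | zero => intro y _ hy0 h; exact absurd (by simpa using h) hy0
    | succ m ih =>
      intro y hy hy0 h
      by_cases hQy : Q y = 0
      · exact ⟨y, hy, hy0, hQy⟩
      · exact ih (Q y) (hS y hy) hQy (by rwa [pow_succ, Module.End.mul_apply] at h)
  exact key k x hx hx0 (by rw [hk, LinearMap.zero_apply])

/-- A rank one endomorphism `z ↦ φ z • x` is nil-clean only if its trace `φ x` is `0` or `1`. -/
theorem apply_eq_zero_or_one_of_idempotent_add_nilpotent {E Q : Module.End K V}
    (hE : IsIdempotentElem E) (hQ : IsNilpotent Q) (φ : V →ₗ[K] K) (x : V)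
    (h : ∀ z, E z + Q z = φ z • x) : φ x = 0 ∨ φ x = 1 := by
  have hEE : ∀ z, E (E z) = E z := fun z => by rw [← Module.End.mul_apply, hE.eq]
  have hQz : ∀ z, Q z = φ z • x - E z := fun z => eq_sub_of_add_eq' (h z)
  by_cases ha : φ x = 0
  · exact Or.inl ha
  right
  have hx : x ≠ 0 := by
    rintro rfl
    exact ha (map_zero φ)
  -- If `E x` lies on the line of `x`, then `x` is an eigenvector of `Q`, with eigenvalue `0`.
  -- Otherwise `x` and `E x` span a `Q`-invariant plane.
  by_cases hd : E x ∈ Submodule.span K {x}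
  · obtain ⟨c, hc⟩ := Submodule.mem_span_singleton.1 hd
    have h1 : c • E x = E x := by
      have := congrArg E hc
      rwa [map_smul, hEE] at this
    have h2 : Q x = (φ x - c) • x := by rw [hQz, ← hc, sub_smul]
    have h3 := eq_zero_of_isNilpotent_of_apply_eq_smul hQ hx h2
    by_cases hEx : E x = 0
    · rw [hEx] at hc
      rw [(smul_eq_zero.1 hc).resolve_right hx, sub_zero] at h3
      exact absurd h3 ha
    · have : (c - 1) • E x = 0 := by rw [sub_smul, h1, one_smul, sub_self]
      have hc1 := sub_eq_zero.1 ((smul_eq_zero.1 this).resolve_right hEx)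
      rw [← hc1]
      exact sub_eq_zero.1 h3
  · have hind : ∀ α β : K, α • x = β • E x → α = 0 ∧ β = 0 := by
      intro α β hαβ
      have hβ : β = 0 := by
        by_contra hβ
        refine hd (Submodule.mem_span_singleton.2 ⟨β⁻¹ * α, ?_⟩)
        rw [mul_smul, hαβ, smul_smul, inv_mul_cancel₀ hβ, one_smul]
      rw [hβ, zero_smul] at hαβ
      exact ⟨(smul_eq_zero.1 hαβ).resolve_right hx, hβ⟩
    have hS : ∀ z ∈ Submodule.span K {x, E x}, Q z ∈ Submodule.span K {x, E x} := by
      intro z hz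
      obtain ⟨α, β, rfl⟩ := Submodule.mem_span_pair.1 hz
      rw [hQz]
      refine Submodule.mem_span_pair.2 ⟨φ (α • x + β • E x), -(α + β), ?_⟩
      rw [map_add E, map_smul E, map_smul E, hEE, ← add_smul, neg_smul, sub_eq_add_neg]
    obtain ⟨w, hw, hw0, hQw⟩ := exists_ne_zero_mem_apply_eq_zero hQ hS
      (Submodule.subset_span (Set.mem_insert x _)) hx
    obtain ⟨α, β, rfl⟩ := Submodule.mem_span_pair.1 hw
    have h1 : φ (α • x + β • E x) • x = (α + β) • E x := by
      have := hQz (α • x + β • E x)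
      rw [hQw, map_add E, map_smul E, map_smul E, hEE, ← add_smul] at this
      exact (sub_eq_zero.1 this.symm)
    obtain ⟨h2, h3⟩ := hind _ _ h1
    -- A kernel vector of `Q` in the plane is thus a multiple of `x - E x`, which forces `φ (E x) =
    -- φ x` and makes `Q x` an eigenvector with eigenvalue `φ x - 1`.
    obtain rfl := eq_neg_of_add_eq_zero_right h3
    have hα : α ≠ 0 := by
      rintro rfl
      simp at hw0
    have h4 : φ (E x) = φ x := by
      rw [map_add, map_smul, map_smul, neg_smul, ← sub_eq_add_neg, ← smul_sub] at h2
      exact (sub_eq_zero.1 ((smul_eq_zero.1 h2).resolve_left hα)).symm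
    have hy : Q x ≠ 0 := by
      intro h0
      rw [hQz, sub_eq_zero] at h0
      exact one_ne_zero (hind (φ x) 1 (by rw [h0, one_smul])).2
    have h5 : Q (Q x) = (φ x - 1) • Q x := by
      rw [hQz (Q x), hQz x, map_sub E, map_smul E, hEE, map_sub φ, map_smul φ, h4, smul_eq_mul,
        sub_smul, sub_smul, one_smul, smul_sub, smul_smul]
      abel
    exact sub_eq_zero.1 (eq_zero_of_isNilpotent_of_apply_eq_smul hQ hy h5)

end RankOne

/-! ### From matrices to the two-element field. -/

theorem Matrix.eq_zero_or_one_of_isNilCleanElem_single {K ι : Type*} [DivisionRing K] [Fintype ι]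
    [DecidableEq ι] (i : ι) {a : K} (h : IsNilCleanElem (Matrix.single i i a)) :
    a = 0 ∨ a = 1 := by
  obtain ⟨e, q, he, ⟨k, hk⟩, heq⟩ := h
  -- Matrices act on row vectors, which is left linear over a noncommutative `K`. The action
  -- reverses products, harmlessly for powers and idempotents.
  have hpow : ∀ m : ℕ, Matrix.toLinearMapRight' q ^ m = Matrix.toLinearMapRight' (q ^ m) := by
    intro m
    induction m with
    | zero => simp [Matrix.toLinearMapRight'_one, Module.End.one_eq_id]
    | succ m ih => rw [pow_succ', ih, pow_succ, Matrix.toLinearMapRight'_mul, Module.End.mul_eq_comp]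
  have := apply_eq_zero_or_one_of_idempotent_add_nilpotent (E := Matrix.toLinearMapRight' e)
    (Q := Matrix.toLinearMapRight' q)
    (by rw [IsIdempotentElem, Module.End.mul_eq_comp, ← Matrix.toLinearMapRight'_mul, he.eq])
    ⟨k, by rw [hpow, hk, map_zero]⟩
    ((LinearMap.proj i).comp (Matrix.toLinearMapRight' (Matrix.single i i a))) (Pi.single i 1)
    (fun z => by
      rw [← LinearMap.add_apply, ← map_add, ← heq]
      ext j
      rcases eq_or_ne j i with rfl | hj
      · simp
      · simp [hj, Matrix.vecMul, dotProduct, Matrix.single_apply, hj.symm])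
  simpa using this

theorem nonempty_ringEquiv_zmod_two {K : Type*} [DivisionRing K] (h : ∀ a : K, a = 0 ∨ a = 1) :
    Nonempty (K ≃+* ZMod 2) := by
  have h2 : ((2 : ℕ) : K) = 0 := by
    rcases h ((2 : ℕ) : K) with h | h
    · exact h
    · exfalso
      have : (1 : K) + 1 = 1 + 0 := by rw [one_add_one_eq_two, add_zero]; exact_mod_cast h
      exact one_ne_zero (add_left_cancel this)
  have : CharP K 2 := CharTwo.of_one_ne_zero_of_two_eq_zero one_ne_zero (by exact_mod_cast h2)
  refine ⟨(RingEquiv.ofBijective (ZMod.castHom (dvd_refl 2) K) ⟨RingHom.injective _, ?_⟩).symm⟩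
  intro a
  rcases h a with rfl | rfl
  · exact ⟨0, map_zero _⟩
  · exact ⟨1, map_one _⟩

/-! ### Block triangular endomorphisms. -/

section Extension

variable {K V : Type*} [Field K] [AddCommGroup V] [Module K V]

/-- If `T` leaves `W` invariant, it is nil-clean as soon as its restriction to `W` and its
compression to a complement of `W` are. -/
theorem isNilCleanElem_of_isCompl {T : Module.End K V} {W C : Submodule K V} (h : IsCompl W C)
    (hW : ∀ z ∈ W, T z ∈ W) (h₁ : IsNilCleanElem (T.restrict hW : Module.End K W))
    (h₂ : IsNilCleanElem ((C.projectionOnto W h.symm ∘ₗ T ∘ₗ C.subtype : C →ₗ[K] C) :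
      Module.End K C)) :
    IsNilCleanElem T := by
  obtain ⟨E₁, Q₁, hE₁, ⟨k, hk⟩, hT₁⟩ := h₁
  obtain ⟨E₂, Q₂, hE₂, ⟨l, hl⟩, hT₂⟩ := h₂
  set p := W.projectionOnto C h
  set r := C.projectionOnto W h.symm
  have hpW : ∀ w : W, p w = w := Submodule.projectionOnto_apply_left h
  have hrC : ∀ c : C, r c = c := Submodule.projectionOnto_apply_left h.symm
  have hpC : ∀ c : C, p c = 0 := Submodule.projectionOnto_apply_right h
  have hrW : ∀ w : W, r w = 0 := Submodule.projectionOnto_apply_right h.symm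
  have hpr : ∀ z, (p z : V) + r z = z := fun z => by
    obtain ⟨w, hw, c, hc, rfl⟩ := Submodule.mem_sup.1 (h.sup_eq_top ▸ Submodule.mem_top (x := z))
    rw [map_add, map_add, hpW ⟨w, hw⟩, hpC ⟨c, hc⟩, hrW ⟨w, hw⟩, hrC ⟨c, hc⟩, add_zero, zero_add]
  have hEE₁ : ∀ z, E₁ (E₁ z) = E₁ z := fun z => by rw [← Module.End.mul_apply, hE₁.eq]
  have hEE₂ : ∀ z, E₂ (E₂ z) = E₂ z := fun z => by rw [← Module.End.mul_apply, hE₂.eq]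
  -- `E` is block diagonal; the off-diagonal block of `T` goes into `T - E`.
  let E : Module.End K V := W.subtype ∘ₗ E₁ ∘ₗ p + C.subtype ∘ₗ E₂ ∘ₗ r
  have hE : ∀ z, E z = (E₁ (p z) : V) + E₂ (r z) := fun z => rfl
  have hQW : ∀ w : W, (T - E) w = Q₁ w := by
    intro w
    have h1 : (T w : V) = E₁ w + Q₁ w := congrArg Subtype.val (LinearMap.congr_fun hT₁ w)
    rw [LinearMap.sub_apply, hE, hpW, hrW, h1]
    simp
  have hQC : ∀ z, r ((T - E) z) = Q₂ (r z) := by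
    intro z
    have h1 : r (T (r z)) = E₂ (r z) + Q₂ (r z) := LinearMap.congr_fun hT₂ (r z)
    have h2 : r (T (p z)) = 0 := hrW ⟨T (p z), hW _ (p z).2⟩
    have h3 : r (T z) = r (T (r z)) := by
      conv_lhs => rw [← hpr z]
      rw [map_add, map_add, h2, zero_add]
    rw [LinearMap.sub_apply, map_sub, h3, h1, hE, map_add, hrW, hrC]
    abel
  have hQWpow : ∀ (m : ℕ) (w : W), ((T - E) ^ m) w = (Q₁ ^ m) w := by
    intro m
    induction m with
    | zero => simp
    | succ m ih => intro w; rw [pow_succ, Module.End.mul_apply, hQW, ih, pow_succ, Module.End.mul_apply]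
  have hQCpow : ∀ (m : ℕ) (z : V), r (((T - E) ^ m) z) = (Q₂ ^ m) (r z) := by
    intro m
    induction m with
    | zero => simp
    | succ m ih => intro z; rw [pow_succ, Module.End.mul_apply, ih, hQC, pow_succ, Module.End.mul_apply]
  refine ⟨E, T - E, ?_, ⟨k + l, ?_⟩, by abel⟩
  · refine LinearMap.ext fun z => ?_
    rw [Module.End.mul_apply, hE (E z), hE z, map_add p, map_add r, hpW, hpC, hrW, hrC, add_zero,
      zero_add, hEE₁, hEE₂]
  · refine LinearMap.ext fun z => ?_
    -- The first `l` steps push every vector into `W`, where `k` more kill it.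
    rw [pow_add, Module.End.mul_apply]
    have h1 : r (((T - E) ^ l) z) = 0 := by rw [hQCpow, hl]; rfl
    have h2 : ((T - E) ^ l) z = p (((T - E) ^ l) z) := by
      conv_lhs => rw [← hpr (((T - E) ^ l) z), h1]
      simp
    rw [h2, hQWpow, hk]
    rfl

end Extension

/-! ### Companion matrices over the field with two elements. -/

section Cyclic

variable {V : Type*} [AddCommGroup V] [Module (ZMod 2) V]

/-- A cyclic endomorphism over the field with two elements is nil-clean. -/
theorem isNilCleanElem_of_cyclic (T : Module.End (ZMod 2) V) (v : V) (k : ℕ)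
    (hli : LinearIndependent (ZMod 2) fun i : Fin k => (T ^ (i : ℕ)) v)
    (hsp : ⊤ ≤ Submodule.span (ZMod 2) (Set.range fun i : Fin k => (T ^ (i : ℕ)) v)) :
    IsNilCleanElem T := by
  let b := Module.Basis.mk hli hsp
  have hb : ∀ i : Fin k, b i = (T ^ (i : ℕ)) v := fun i => by simp [b]
  have : Module.Finite (ZMod 2) V := Module.Finite.of_basis b
  let S : ℕ → Submodule (ZMod 2) V := fun j =>
    Submodule.span (ZMod 2) ((fun i : ℕ => (T ^ i) v) '' Set.Iio j)
  have hS0 : S 0 = ⊥ := by simp [S]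
  have hS : ∀ j, ∀ z ∈ S (j + 1), ∃ c : ZMod 2, ∃ y ∈ S j, z = c • (T ^ j) v + y := by
    intro j z hz
    have : Set.Iio (j + 1) = insert j (Set.Iio j) := by ext i; simp
    simp only [S, this, Set.image_insert_eq] at hz
    exact Submodule.mem_span_insert.1 hz
  have htop : ∀ z, z ∈ S k := by
    intro z
    refine Submodule.span_mono ?_ (hsp (Submodule.mem_top (x := z)))
    rintro _ ⟨i, rfl⟩
    exact ⟨i, i.2, rfl⟩
  have hker : ∀ (E : Module.End (ZMod 2) V) (j : ℕ), (∀ i < j, E ((T ^ i) v) = 0) →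
      ∀ z ∈ S j, E z = 0 := by
    intro E j hE z hz
    have : S j ≤ LinearMap.ker E := by
      refine Submodule.span_le.2 ?_
      rintro _ ⟨i, hi, rfl⟩
      exact hE i hi
    exact this hz
  have hext : ∀ f : ℕ → V, ∃ E : Module.End (ZMod 2) V, ∀ i < k, E ((T ^ i) v) = f i := by
    intro f
    refine ⟨b.constr (ZMod 2) fun i => f i, fun i hi => ?_⟩
    rw [← hb ⟨i, hi⟩, Module.Basis.constr_basis]
  have hidem : ∀ E : Module.End (ZMod 2) V, (∀ i < k, E (E ((T ^ i) v)) = E ((T ^ i) v)) →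
      IsIdempotentElem E := by
    intro E hE
    refine b.ext fun i => ?_
    rw [hb, Module.End.mul_apply, hE i i.2]
  have hstep : ∀ (Q : Module.End (ZMod 2) V) (z : V), (∃ n, (Q ^ n) (Q z) = 0) →
      ∃ n, (Q ^ n) z = 0 := by
    rintro Q z ⟨n, hn⟩
    exact ⟨n + 1, by rw [pow_succ, Module.End.mul_apply, hn]⟩
  -- If `Q` shifts the basis up to index `j`, only the basis vectors from `j` on need checking.
  have hnil : ∀ (Q : Module.End (ZMod 2) V) (j : ℕ), j < k →
      (∀ i < j, Q ((T ^ i) v) = (T ^ (i + 1)) v) →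
      (∀ i, j ≤ i → i < k → ∃ n, (Q ^ n) ((T ^ i) v) = 0) → IsNilpotent Q := by
    intro Q j hj h1 h2
    have h3 : ∀ d i, i < k → j ≤ i + d → ∃ n, (Q ^ n) ((T ^ i) v) = 0 := by
      intro d
      induction d with
      | zero => exact fun i hi hji => h2 i hji hi
      | succ d ih =>
        intro i hi hji
        rcases le_or_gt j i with hij | hij
        · exact h2 i hij hi
        · refine hstep Q _ ?_
          rw [h1 i hij]
          exact ih (i + 1) (by omega) (by omega)
    rw [Module.End.isNilpotent_iff_of_finite]
    intro z
    have h4 : z ∈ Q.maxGenEigenspace 0 := by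
      have : S k ≤ Q.maxGenEigenspace 0 := by
        refine Submodule.span_le.2 ?_
        rintro _ ⟨i, hi, rfl⟩
        simpa [Module.End.mem_maxGenEigenspace] using h3 j i hi (by omega)
      exact this (htop z)
    simpa [Module.End.mem_maxGenEigenspace] using h4
  have hTnil : (∃ m, k = m + 1 ∧ (T ^ (m + 1)) v = 0) → IsNilCleanElem T := by
    rintro ⟨m, rfl, hm⟩
    refine ⟨0, T, IsIdempotentElem.zero, ?_, (zero_add T).symm⟩
    refine hnil T 0 (by omega) (by simp) fun i _ hi => ⟨m + 1 - i, ?_⟩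
    rw [← Module.End.mul_apply, ← pow_add, Nat.sub_add_cancel hi.le, hm]
  have hT : ∀ i, T ((T ^ i) v) = (T ^ (i + 1)) v := fun i => by
    rw [pow_succ', Module.End.mul_apply]
  have hz2 : ∀ c : ZMod 2, c = 0 ∨ c = 1 := by decide
  obtain _ | m := k
  · have h0 : ∀ z : V, z = 0 := fun z => by simpa [hS0] using htop z
    exact ⟨0, 0, IsIdempotentElem.zero, IsNilpotent.zero, LinearMap.ext fun z => by
      rw [h0 (T z)]; simp⟩
  -- `c` is the trace of `T`. Modulo 2 it must equal the rank of the idempotent, hence rank one for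
  -- `c = 1` and rank two in the non-nilpotent cases with `c = 0`.
  obtain ⟨c, y, hy, hc⟩ := hS m _ (htop ((T ^ (m + 1)) v))
  rcases hz2 c with rfl | rfl
  swap
  -- `E` takes over the whole last column, leaving the truncated shift.
  · obtain ⟨E, hE⟩ := hext fun i => if i = m then (T ^ (m + 1)) v else 0
    have hE0 : ∀ i < m, E ((T ^ i) v) = 0 := fun i hi => by
      rw [hE i (by omega), if_neg (by omega)]
    have hEm : E ((T ^ m) v) = (T ^ (m + 1)) v := by rw [hE m (by omega), if_pos rfl]
    refine ⟨E, T - E, hidem E fun i hi => ?_, hnil _ m (by omega) (fun i hi => ?_)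
      (fun i hi hi' => hstep _ _ ⟨0, ?_⟩), (add_sub_cancel E T).symm⟩
    · rcases Nat.lt_succ_iff_lt_or_eq.1 hi with hi | rfl
      · rw [hE0 i hi, map_zero]
      · rw [hEm]
        conv_lhs => rw [hc]
        rw [map_add, hker E i hE0 y hy, one_smul, add_zero, hEm]
    · rw [LinearMap.sub_apply, hE0 i hi, hT, sub_zero]
    · obtain rfl : i = m := by omega
      rw [LinearMap.sub_apply, hEm, hT, sub_self, map_zero]
  rw [zero_smul, zero_add] at hc
  subst hc
  obtain _ | p := m
  · rw [hS0, Submodule.mem_bot] at hy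
    exact hTnil ⟨0, rfl, hy⟩
  obtain ⟨s, g, hg, hs⟩ := hS p _ hy
  rcases hz2 s with rfl | rfl
  · rw [zero_smul, zero_add] at hs
    obtain _ | q := p
    · rw [hS0, Submodule.mem_bot] at hg
      exact hTnil ⟨1, rfl, hs.trans hg⟩
    -- The two top coefficients vanish. `T - E` preserves the span of the last three basis vectors
    -- and, in characteristic two, its cube is zero there.
    obtain ⟨E, hE⟩ := hext fun i => if i = q + 1 then (T ^ (q + 1)) v + (T ^ q) v
      else if i = q + 2 then g + (T ^ (q + 2)) v + (T ^ q) v else 0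
    have hE0 : ∀ i < q + 1, E ((T ^ i) v) = 0 := fun i hi => by
      rw [hE i (by omega), if_neg (by omega), if_neg (by omega)]
    have hE1 : E ((T ^ (q + 1)) v) = (T ^ (q + 1)) v + (T ^ q) v := by
      rw [hE _ (by omega), if_pos rfl]
    have hE2 : E ((T ^ (q + 2)) v) = g + (T ^ (q + 2)) v + (T ^ q) v := by
      rw [hE _ (by omega), if_neg (by omega), if_pos rfl]
    have hEg := hker E _ hE0 g hg
    have hQ0 : ∀ i < q + 1, (T - E) ((T ^ i) v) = (T ^ (i + 1)) v := fun i hi => by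
      rw [LinearMap.sub_apply, hE0 i hi, hT, sub_zero]
    have hQq := hQ0 q (by omega)
    have hQ1 : (T - E) ((T ^ (q + 1)) v) = (T ^ (q + 2)) v - (T ^ (q + 1)) v - (T ^ q) v := by
      rw [LinearMap.sub_apply, hE1, hT]; abel
    have hQ2 : (T - E) ((T ^ (q + 2)) v) = - (T ^ (q + 2)) v - (T ^ q) v := by
      rw [LinearMap.sub_apply, hE2, hT, hs]; abel
    refine ⟨E, T - E, hidem E fun i hi => ?_, hnil _ (q + 1) (by omega) hQ0
      (fun i hi hi' => hstep _ _ <| hstep _ _ <| hstep _ _ ⟨0, ?_⟩), (add_sub_cancel E T).symm⟩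
    · obtain hi | rfl | rfl : i < q + 1 ∨ i = q + 1 ∨ i = q + 2 := by omega
      · rw [hE0 i hi, map_zero]
      · rw [hE1, map_add, hE1, hE0 q (by omega), add_zero]
      · rw [hE2, map_add, map_add, hE2, hE0 q (by omega), hEg, add_zero, zero_add]
    · generalize T - E = Q at *
      obtain rfl | rfl : i = q + 1 ∨ i = q + 2 := by omega
      · simp only [hQ1, hQ2, hQq, map_sub, map_neg, pow_zero, Module.End.one_apply]
        refine Eq.trans ?_ (ZModModule.add_self ((T ^ (q + 2)) v + (T ^ q) v))
        abel
      · simp only [hQ1, hQ2, hQq, map_sub, map_neg, pow_zero, Module.End.one_apply]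
        refine Eq.trans ?_ (ZModModule.add_self ((T ^ (q + 1)) v - (T ^ (q + 2)) v))
        abel
  · rw [one_smul] at hs
    -- Here `T - E` preserves the span of the last two basis vectors and has square zero there.
    obtain ⟨E, hE⟩ := hext fun i => if i = p then (T ^ p) v
      else if i = p + 1 then g + (T ^ (p + 1)) v else 0
    have hE0 : ∀ i < p, E ((T ^ i) v) = 0 := fun i hi => by
      rw [hE i (by omega), if_neg (by omega), if_neg (by omega)]
    have hE1 : E ((T ^ p) v) = (T ^ p) v := by
      rw [hE _ (by omega), if_pos rfl]
    have hE2 : E ((T ^ (p + 1)) v) = g + (T ^ (p + 1)) v := by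
      rw [hE _ (by omega), if_neg (by omega), if_pos rfl]
    have hEg := hker E _ hE0 g hg
    have hQ1 : (T - E) ((T ^ p) v) = (T ^ (p + 1)) v - (T ^ p) v := by
      rw [LinearMap.sub_apply, hE1, hT]
    have hQ2 : (T - E) ((T ^ (p + 1)) v) = (T ^ p) v - (T ^ (p + 1)) v := by
      rw [LinearMap.sub_apply, hE2, hT, hs]; abel
    refine ⟨E, T - E, hidem E fun i hi => ?_, hnil _ p (by omega) (fun i hi => ?_)
      (fun i hi hi' => hstep _ _ <| hstep _ _ ⟨0, ?_⟩), (add_sub_cancel E T).symm⟩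
    · obtain hi | rfl | rfl : i < p ∨ i = p ∨ i = p + 1 := by omega
      · rw [hE0 i hi, map_zero]
      · rw [hE1, hE1]
      · rw [hE2, map_add, hE2, hEg, zero_add]
    · rw [LinearMap.sub_apply, hE0 i hi, hT, sub_zero]
    · generalize T - E = Q at *
      obtain rfl | rfl : i = p ∨ i = p + 1 := by omega
      · simp only [hQ1, hQ2, map_sub, pow_zero, Module.End.one_apply]
        refine Eq.trans ?_ (ZModModule.add_self ((T ^ i) v - (T ^ (i + 1)) v))
        abel
      · simp only [hQ1, hQ2, map_sub, pow_zero, Module.End.one_apply]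
        refine Eq.trans ?_ (ZModModule.add_self ((T ^ (p + 1)) v - (T ^ p) v))
        abel

end Cyclic

/-! ### Induction on dimension and the main theorem. -/

/-- Every endomorphism of a finite-dimensional space over the field with two elements is
nil-clean. -/
theorem isNilCleanElem_end_zmod_two (d : ℕ) : ∀ {V : Type*} [AddCommGroup V] [Module (ZMod 2) V]
    [FiniteDimensional (ZMod 2) V] (_ : Module.finrank (ZMod 2) V = d)
    (T : Module.End (ZMod 2) V), IsNilCleanElem T := by
  induction d using Nat.strong_induction_on with
  | _ d ih =>
  intro V _ _ _ hd T
  rcases subsingleton_or_nontrivial V with hV | hV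
  · exact ⟨0, 0, IsIdempotentElem.zero, IsNilpotent.zero, Subsingleton.elim _ _⟩
  obtain ⟨v, hv⟩ := exists_ne (0 : V)
  let u : ∀ k : ℕ, Fin k → V := fun k i => (T ^ (i : ℕ)) v
  have hli : ∀ k : ℕ, (∀ j < k, (T ^ j) v ∉ Submodule.span (ZMod 2) (Set.range (u j))) →
      LinearIndependent (ZMod 2) (u k) := by
    intro k
    induction k with
    | zero => exact fun _ => linearIndependent_empty_type
    | succ k ihk =>
      intro h
      exact linearIndependent_finSucc'.2 ⟨ihk fun j hj => h j (by omega), h k (by omega)⟩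
  have hex : ∃ k : ℕ, (T ^ k) v ∈ Submodule.span (ZMod 2) (Set.range (u k)) := by
    by_contra! hne
    have := (hli (Module.finrank (ZMod 2) V + 1) fun j _ => hne j).fintype_card_le_finrank
    simp at this
  classical
  -- Minimality of `k` makes the first `k` iterates of `v` independent; membership at `k` makes
  -- their span invariant.
  set k := Nat.find hex
  have hk : (T ^ k) v ∈ Submodule.span (ZMod 2) (Set.range (u k)) := Nat.find_spec hex
  have hlik := hli k fun j hj => Nat.find_min hex hj
  have hk0 : 0 < k := by
    rcases Nat.eq_zero_or_pos k with h0 | h0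
    · rw [h0] at hk
      simp [hv] at hk
    · exact h0
  set W := Submodule.span (ZMod 2) (Set.range (u k))
  have huW : ∀ i : Fin k, u k i ∈ W := fun i => Submodule.subset_span ⟨i, rfl⟩
  have hW : ∀ z ∈ W, T z ∈ W := by
    have : W ≤ W.comap T := by
      refine Submodule.span_le.2 ?_
      rintro _ ⟨i, rfl⟩
      have hi : T (u k i) = (T ^ ((i : ℕ) + 1)) v := by rw [pow_succ', Module.End.mul_apply]
      change T (u k i) ∈ W
      rw [hi]
      rcases Nat.lt_or_ge ((i : ℕ) + 1) k with h | h
      · exact huW ⟨i + 1, h⟩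
      · rw [le_antisymm i.2 h]
        exact hk
    exact this
  have hvW : v ∈ W := huW ⟨0, hk0⟩
  have hcoe : ∀ i : ℕ, ((((T.restrict hW : Module.End (ZMod 2) W) ^ i) ⟨v, hvW⟩ : W) : V) =
      (T ^ i) v := by
    intro i
    induction i with
    | zero => rfl
    | succ i ihi =>
      rw [pow_succ', pow_succ', Module.End.mul_apply, Module.End.mul_apply, ← ihi]
      rfl
  have hcoe' : (W.subtype ∘ fun i : Fin k =>
      ((T.restrict hW : Module.End (ZMod 2) W) ^ (i : ℕ)) ⟨v, hvW⟩) = u k :=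
    funext fun i => hcoe i
  obtain ⟨C, hC⟩ := W.exists_isCompl
  refine isNilCleanElem_of_isCompl hC hW (isNilCleanElem_of_cyclic _ ⟨v, hvW⟩ k ?_ ?_) ?_
  · refine LinearIndependent.of_comp W.subtype ?_
    rw [hcoe']
    exact hlik
  · refine (Submodule.map_le_map_iff_of_injective W.injective_subtype _ _).1 ?_
    rw [Submodule.map_span, ← Set.range_comp, hcoe', Submodule.map_subtype_top]
  · refine ih (Module.finrank (ZMod 2) C) ?_ rfl _
    have : Nontrivial W := ⟨⟨⟨v, hvW⟩, 0, fun h => hv (congrArg Subtype.val h)⟩⟩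
    have h1 := Submodule.finrank_add_eq_of_isCompl hC
    have h2 : 0 < Module.finrank (ZMod 2) W := Module.finrank_pos
    omega

theorem mainTheorem8 (D : Type*) [DivisionRing D] (n : ℕ) (hn : 2 ≤ n) :
    IsGNC (Matrix (Fin n) (Fin n) D) ↔ Nonempty (D ≃+* ZMod 2) := by
  constructor
  · intro h
    refine nonempty_ringEquiv_zmod_two fun a => ?_
    refine Matrix.eq_zero_or_one_of_isNilCleanElem_single (⟨0, by omega⟩ : Fin n) (h _ ?_)
    intro hu
    obtain ⟨B, hB⟩ := hu.exists_right_inv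
    -- Since `n ≥ 2` there is a row with index 1, and it is zero in `single 0 0 a`.
    have := congrFun (congrFun hB ⟨1, by omega⟩) ⟨1, by omega⟩
    rw [Matrix.single_mul_apply_of_ne _ _ _ _ _ (by simp), Matrix.one_apply_eq] at this
    exact zero_ne_one this
  · rintro ⟨f⟩ A -
    have h := isNilCleanElem_end_zmod_two _ rfl (Matrix.toLinAlgEquiv' (f.mapMatrix A))
    have h' := (h.map (Matrix.toLinAlgEquiv' (R := ZMod 2) (n := Fin n)).symm.toRingEquiv.toRingHom).map
      f.mapMatrix.symm.toRingHom
    have hA : f.mapMatrix.symm.toRingHom ((Matrix.toLinAlgEquiv' (R := ZMod 2)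
        (n := Fin n)).symm.toRingEquiv.toRingHom (Matrix.toLinAlgEquiv' (f.mapMatrix A))) = A := by
      change f.mapMatrix.symm (Matrix.toLinAlgEquiv'.symm (Matrix.toLinAlgEquiv' _)) = A
      rw [AlgEquiv.symm_apply_apply, RingEquiv.symm_apply_apply]
    rwa [hA] at h'
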